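/- For a topological space $Z$ let $2^Z$ be the space of all non-empty closed subsets of $Z$ with the Vietoris topology, and for $n\in\mathbb N$ let $\exp_n(Z)=\{A\in 2^Z: |A|\le n\}$ with the subspace topology. Let $X$ be a closed subspace of $\mathbb R^k$ and let $f:X\to \exp_n(\mathbb R^k)$ be continuous. Let $\beta X$ and $\beta\mathbb R^k$ be the Stone–Čech compactifications; since $X$ is closed in the normal space $\mathbb R^k$, the inclusion $X\subseteq\mathbb R^k$ extends to an embedding $\beta X\to\beta\mathbb R^k$, by which $\beta X$ is regarded as a subspace of $\beta\mathbb R^k$; likewise $\exp_n(\mathbb R^k)$ is regarded as a subset of $\exp_n(\beta\mathbb R^k)$. Then $f$ has a unique continuous extension $\tilde f:\beta X\to\exp_n(\beta\mathbb R^k)$, and $f$ is fixed-point free (that is, $x\notin f(x)$ for every $x\in X$) if and only if $\tilde f$ is fixed-point free (that is, $p\notin\tilde f(p)$ for every $p\in\beta X$). -/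

import Mathlib

/-- The hyperspace `2^Z`: the nonempty closed subsets of `Z`, with the Vietoris topology. -/
def Hyperspace (Z : Type*) [TopologicalSpace Z] : Type _ :=
  {A : Set Z // A.Nonempty ∧ IsClosed A}

namespace Hyperspace

instance instTopologicalSpace (Z : Type*) [TopologicalSpace Z] :
    TopologicalSpace (Hyperspace Z) :=
  TopologicalSpace.induced Subtype.val (TopologicalSpace.vietoris Z)

end Hyperspace

/-- The subspace `exp_n(Z)` of `2^Z` of all `A` with `|A| ≤ n`. -/
def HyperExp (n : ℕ) (Z : Type*) [TopologicalSpace Z] : Type _ :=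
  {A : Hyperspace Z // A.1.encard ≤ (n : ℕ∞)}

namespace HyperExp

instance instTopologicalSpace (n : ℕ) (Z : Type*) [TopologicalSpace Z] :
    TopologicalSpace (HyperExp n Z) :=
  TopologicalSpace.induced Subtype.val (Hyperspace.instTopologicalSpace Z)

/-- The underlying set of points of a member of `exp_n(Z)`. -/
def carrier {n : ℕ} {Z : Type*} [TopologicalSpace Z] (A : HyperExp n Z) : Set Z := A.1.1

end HyperExp

/-- For `X` regarded as a subset of `Z` by means of the injection `i`, a multivalued map
`f : X → exp_n(Z)` is fixed-point free if `x ∉ f(x)` for every `x ∈ X`. -/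
def FixedPointFree {X Z : Type*} [TopologicalSpace Z] {n : ℕ} (i : X → Z)
    (f : X → HyperExp n Z) : Prop :=
  ∀ x : X, i x ∉ (f x).carrier

/-- The canonical map `βX → βZ` for a subspace `X` of `Z`: the continuous map that sends each
point of `X` to itself. For `X` closed in a normal space `Z` it identifies `βX` with a subspace
of `βZ` (see `betaInclusion_isEmbedding`). -/
noncomputable def betaInclusion {Z : Type*} [TopologicalSpace Z] (X : Set Z) :
    StoneCech X → StoneCech Z :=
  stoneCechExtend (continuous_stoneCechUnit.comp (continuous_subtype_val (p := (· ∈ X))))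

theorem betaInclusion_unit {Z : Type*} [TopologicalSpace Z] (X : Set Z) (x : X) :
    betaInclusion X (stoneCechUnit x) = stoneCechUnit (x : Z) :=
  stoneCechExtend_stoneCechUnit _ x

theorem betaInclusion_isEmbedding {Z : Type*} [TopologicalSpace Z] [NormalSpace Z] {X : Set Z}
    (hX : IsClosed X) : Topology.IsEmbedding (betaInclusion X) := by
  have hc : Continuous (betaInclusion X) := continuous_stoneCechExtend _
  refine (hc.isClosedEmbedding ?_).isEmbedding
  intro p q hpq
  by_contra hne
  obtain ⟨g, hg, hgp, hgq⟩ := CompletelyRegularSpace.completely_regular p {q}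
    isClosed_singleton (by simpa using hne)
  obtain ⟨h, hh⟩ := ContinuousMap.exists_extension hX.isClosedEmbedding_subtypeVal
    (⟨fun x : X => g (stoneCechUnit x), hg.comp continuous_stoneCechUnit⟩ : C(X, unitInterval))
  have key : stoneCechExtend h.continuous ∘ betaInclusion X = g := by
    refine stoneCech_hom_ext ((continuous_stoneCechExtend _).comp hc) hg ?_
    funext x
    have hx := DFunLike.congr_fun hh x
    simp only [Function.comp_apply, betaInclusion_unit, stoneCechExtend_stoneCechUnit]
    exact hx
  have h1 := congrFun key p
  have h2 := congrFun key q
  simp only [Function.comp_apply] at h1 h2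
  rw [hpq, h2, hgp] at h1
  have h3 : g q = 1 := hgq rfl
  rw [h3] at h1
  exact one_ne_zero h1

/-- `F : βX → exp_n(βZ)` is a continuous extension of `f : X → exp_n(Z)`, where `X ⊆ βX` and
`exp_n(Z) ⊆ exp_n(βZ)` by the canonical maps. -/
def IsBetaExtension {X Z : Type*} [TopologicalSpace X] [TopologicalSpace Z] {n : ℕ}
    (f : X → HyperExp n Z) (F : StoneCech X → HyperExp n (StoneCech Z)) : Prop :=
  Continuous F ∧ ∀ x : X, (F (stoneCechUnit x)).carrier = stoneCechUnit '' (f x).carrier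

/-! The extension exists and is unique because `exp_n(βZ)` is compact Hausdorff: it is a continuous
image of `(βZ)^n`, and the universal property of `βX` applies.

If `f` has a fixed point `x`, so does its extension. For the converse it suffices to find a finite
open cover `W t` of `ℝ^k` such that `f(x)` misses `W t` whenever `x ∈ W t`. Urysohn functions turn
this into closed conditions that hold on `X`, hence on all of `βX`, and exclude fixed points there
(`IsBetaExtension.fixedPointFree_of_cover`).

The cover comes from a greedy colouring of small cells with disjoint closures. Finite dimension
gives covers in which each point lies in the closures of at most `|κ| = 2^k` colour classes. A value
`f(x)` of at most `n` points then meets at most `n * 2^k` such closures, so with one more colour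
some colour is free, and no point is sent to an earlier cell of its own colour. Intersecting the
colourings for two orders also excludes later cells, and a small cell is disjoint from its own
image. An infinite sequence cannot be reversed, so the cells are grouped into finite levels, given
by shells so thick that no image reaches a higher level; only the order inside each level is
reversed (`HasColoredCovers.exists_coloring_levels`). -/

open Set Topology

/-! ### The Vietoris topology on `exp_n` -/

namespace HyperExp

variable {n : ℕ} {Z : Type*} [TopologicalSpace Z]

theorem continuous_carrier :
    @Continuous _ _ _ (TopologicalSpace.vietoris Z) (carrier : HyperExp n Z → Set Z) := by
  let _ := TopologicalSpace.vietoris Z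
  exact (continuous_induced_dom (f := (Subtype.val : Hyperspace Z → Set Z))).comp
    (continuous_induced_dom (f := (Subtype.val : HyperExp n Z → Hyperspace Z)))

theorem isOpen_subset {U : Set Z} (hU : IsOpen U) :
    IsOpen {A : HyperExp n Z | A.carrier ⊆ U} := by
  let _ := TopologicalSpace.vietoris Z
  exact hU.powerset_vietoris.preimage continuous_carrier

theorem isOpen_meets {U : Set Z} (hU : IsOpen U) :
    IsOpen {A : HyperExp n Z | (A.carrier ∩ U).Nonempty} := by
  let _ := TopologicalSpace.vietoris Z
  exact (TopologicalSpace.vietoris.isOpen_inter_nonempty_of_isOpen hU).preimage continuous_carrier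

theorem isClosed_subset {C : Set Z} (hC : IsClosed C) :
    IsClosed {A : HyperExp n Z | A.carrier ⊆ C} := by
  let _ := TopologicalSpace.vietoris Z
  exact hC.powerset_vietoris.preimage continuous_carrier

theorem continuous_of_isOpen_preimage {Y : Type*} [TopologicalSpace Y] {g : Y → HyperExp n Z}
    (h₁ : ∀ U, IsOpen U → IsOpen {y | (g y).carrier ⊆ U})
    (h₂ : ∀ U, IsOpen U → IsOpen {y | ((g y).carrier ∩ U).Nonempty}) : Continuous g := by
  let _ := TopologicalSpace.vietoris Z
  refine continuous_induced_rng.2 (continuous_induced_rng.2 ?_)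
  rw [continuous_generateFrom_iff]
  rintro _ (⟨U, hU, rfl⟩ | ⟨U, hU, rfl⟩)
  · exact h₁ U hU
  · exact h₂ U hU

theorem carrier_injective : Function.Injective (carrier : HyperExp n Z → Set Z) :=
  Subtype.val_injective.comp Subtype.val_injective

theorem carrier_nonempty (A : HyperExp n Z) : A.carrier.Nonempty := A.1.2.1

theorem isClosed_carrier (A : HyperExp n Z) : IsClosed A.carrier := A.1.2.2

theorem encard_carrier_le (A : HyperExp n Z) : A.carrier.encard ≤ n := A.2

theorem finite_carrier (A : HyperExp n Z) : A.carrier.Finite :=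
  finite_of_encard_le_coe A.encard_carrier_le

/-- A nonempty set of at most `n` points in a `T₁` space, as a member of `exp_n`. -/
def ofSet [T1Space Z] (s : Set Z) (hne : s.Nonempty) (hs : s.encard ≤ n) : HyperExp n Z :=
  ⟨⟨s, hne, (finite_of_encard_le_coe hs).isClosed⟩, hs⟩

/-- If `a ∈ A` is not in `B`, regularity separates `a` from `B`; meeting one open set and lying in
the other separate `A` from `B`. -/
instance instT2Space [T3Space Z] : T2Space (HyperExp n Z) := by
  have key : ∀ A B : HyperExp n Z, ¬ A.carrier ⊆ B.carrier → ∃ u v : Set (HyperExp n Z),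
      IsOpen u ∧ IsOpen v ∧ A ∈ u ∧ B ∈ v ∧ Disjoint u v := by
    intro A B h
    obtain ⟨a, haA, haB⟩ := not_subset.1 h
    obtain ⟨U, V, hU, hV, hBU, haV, hUV⟩ :=
      (separatedNhds_iff_disjoint (s := B.carrier) (t := {a})).2 (by
        rw [nhdsSet_singleton]
        exact RegularSpace.regular B.isClosed_carrier haB)
    exact ⟨_, _, isOpen_meets hV, isOpen_subset hU, ⟨a, haA, haV rfl⟩, hBU,
      disjoint_left.2 fun C ⟨c, hc, hcV⟩ hCU => hUV.le_bot ⟨hCU hc, hcV⟩⟩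
  refine ⟨fun A B hAB => ?_⟩
  by_cases h : A.carrier ⊆ B.carrier
  · have h' : ¬ B.carrier ⊆ A.carrier := fun h' => hAB (carrier_injective (h.antisymm h'))
    obtain ⟨u, v, hu, hv, hBu, hAv, huv⟩ := key B A h'
    exact ⟨v, u, hv, hu, hAv, hBu, huv.symm⟩
  · exact key A B h

instance instCompactSpace [T1Space Z] [CompactSpace Z] : CompactSpace (HyperExp n Z) := by
  -- For `n = 0` the range map would take the value `∅`, which is not a member.
  rcases isEmpty_or_nonempty (Fin n) with hn | hn
  · have : IsEmpty (HyperExp n Z) := by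
      refine ⟨fun A => ?_⟩
      have hn0 : n = 0 := Nat.eq_zero_of_not_pos fun h => hn.elim ⟨0, h⟩
      subst hn0
      exact A.carrier_nonempty.ne_empty (by simpa using A.encard_carrier_le)
    infer_instance
  · let g : (Fin n → Z) → HyperExp n Z := fun x => ofSet (range x) (range_nonempty x) (by
      rw [← image_univ]
      exact (encard_image_le _ _).trans (by simp))
    have hg : Continuous g := by
      refine continuous_of_isOpen_preimage (fun U hU => ?_) fun U hU => ?_
      · have : {x | (g x).carrier ⊆ U} = ⋂ i, (fun x : Fin n → Z => x i) ⁻¹' U := by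
          ext x
          simp only [mem_iInter]
          exact range_subset_iff
        rw [this]
        exact isOpen_iInter_of_finite fun i => hU.preimage (continuous_apply i)
      · have : {x | ((g x).carrier ∩ U).Nonempty} = ⋃ i, (fun x : Fin n → Z => x i) ⁻¹' U := by
          ext x
          simp only [mem_iUnion]
          constructor
          · rintro ⟨_, ⟨i, rfl⟩, hi⟩
            exact ⟨i, hi⟩
          · rintro ⟨i, hi⟩
            exact ⟨x i, ⟨i, rfl⟩, hi⟩
        rw [this]
        exact isOpen_iUnion fun i => hU.preimage (continuous_apply i)
    have hsurj : Function.Surjective g := by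
      intro A
      have hfin := A.finite_carrier
      have := hfin.fintype
      have : Nonempty A.carrier := A.carrier_nonempty.to_subtype
      have hcard : Fintype.card A.carrier ≤ Fintype.card (Fin n) := by
        have := A.encard_carrier_le
        rw [← coe_fintypeCard] at this
        rw [Fintype.card_fin]
        exact_mod_cast this
      obtain ⟨e⟩ := Function.Embedding.nonempty_of_card_le hcard
      refine ⟨fun i => (Function.invFun e i : A.carrier), carrier_injective ?_⟩
      change range _ = _
      rw [range_comp' Subtype.val, (Function.invFun_surjective e.injective).range_eq]
      simp
    exact ⟨hsurj.range_eq ▸ isCompact_range hg⟩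

/-- The map `exp_n(Z) → exp_n(Y)` induced by a map into a `T₁` space. -/
def map {Y : Type*} [TopologicalSpace Y] [T1Space Y] (g : Z → Y) (A : HyperExp n Z) :
    HyperExp n Y :=
  ofSet (g '' A.carrier) (A.carrier_nonempty.image g) ((encard_image_le _ _).trans A.2)

theorem carrier_map {Y : Type*} [TopologicalSpace Y] [T1Space Y] (g : Z → Y) (A : HyperExp n Z) :
    (map g A).carrier = g '' A.carrier := rfl

theorem continuous_map {Y : Type*} [TopologicalSpace Y] [T1Space Y] {g : Z → Y}
    (hg : Continuous g) : Continuous (map g : HyperExp n Z → HyperExp n Y) := by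
  refine continuous_of_isOpen_preimage (fun U hU => ?_) fun U hU => ?_
  · simp only [carrier_map, image_subset_iff]
    exact isOpen_subset (hU.preimage hg)
  · simp only [carrier_map, image_inter_nonempty_iff]
    exact isOpen_meets (hU.preimage hg)

end HyperExp

/-! ### Extension to the Stone–Čech compactification -/

theorem existsUnique_isBetaExtension {X Z : Type*} [TopologicalSpace X] [TopologicalSpace Z] {n : ℕ}
    {f : X → HyperExp n Z} (hf : Continuous f) :
    ∃! F : StoneCech X → HyperExp n (StoneCech Z), IsBetaExtension f F := by
  have hc : Continuous fun x => HyperExp.map (stoneCechUnit : Z → StoneCech Z) (f x) :=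
    (HyperExp.continuous_map continuous_stoneCechUnit).comp hf
  refine ⟨stoneCechExtend hc, ⟨continuous_stoneCechExtend hc, fun x => ?_⟩, fun G hG => ?_⟩
  · rw [stoneCechExtend_stoneCechUnit hc, HyperExp.carrier_map]
  · refine stoneCech_hom_ext hG.1 (continuous_stoneCechExtend hc) (funext fun x => ?_)
    refine HyperExp.carrier_injective ?_
    simp only [Function.comp_apply]
    rw [stoneCechExtend_stoneCechUnit hc, HyperExp.carrier_map, hG.2]

theorem FixedPointFree.of_isBetaExtension {Z : Type*} [TopologicalSpace Z] {n : ℕ} {X : Set Z}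
    {f : X → HyperExp n Z} {F : StoneCech X → HyperExp n (StoneCech Z)}
    (hF : IsBetaExtension f F) (h : FixedPointFree (betaInclusion X) F) :
    FixedPointFree (Subtype.val : X → Z) f := by
  intro x hx
  apply h (stoneCechUnit x)
  rw [hF.2, betaInclusion_unit]
  exact mem_image_of_mem _ hx

/-- A continuous multivalued map with a finite open colouring has a fixed-point free extension. -/
theorem IsBetaExtension.fixedPointFree_of_cover {Z : Type*} [TopologicalSpace Z] [NormalSpace Z]
    {n : ℕ} {X : Set Z} {f : X → HyperExp n Z} {F : StoneCech X → HyperExp n (StoneCech Z)}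
    (hF : IsBetaExtension f F) {ι : Type*} [Finite ι] {W : ι → Set Z} (hWo : ∀ t, IsOpen (W t))
    (hWc : ⋃ t, W t = univ) (hW : ∀ t (x : X), (x : Z) ∈ W t → Disjoint (f x).carrier (W t)) :
    FixedPointFree (betaInclusion X) F := by
  obtain ⟨V, hVc, hVcl, hVW⟩ :=
    exists_iUnion_eq_closed_subset hWo (fun _ => Set.toFinite _) hWc
  have hg : ∀ t, ∃ g : Z → unitInterval, Continuous g ∧ (∀ z ∈ (W t)ᶜ, g z = 0) ∧
      ∀ z ∈ V t, g z = 1 := by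
    intro t
    obtain ⟨g, hg0, hg1, hgI⟩ := exists_continuous_zero_one_of_isClosed
      (hWo t).isClosed_compl (hVcl t) (disjoint_compl_left_iff_subset.2 (hVW t))
    exact ⟨fun z => ⟨g z, hgI z⟩, by fun_prop, fun z hz => Subtype.ext (hg0 hz),
      fun z hz => Subtype.ext (hg1 hz)⟩
  choose g hgc hg0 hg1 using hg
  have hι : Continuous (betaInclusion X) := continuous_stoneCechExtend _
  -- A fixed point in `T t` would force the extended `g t` to be both `1` and `0` there.
  let T : ι → Set (StoneCech X) := fun t =>
    {p | stoneCechExtend (hgc t) (betaInclusion X p) = 1} ∩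
      {p | (F p).carrier ⊆ {q | stoneCechExtend (hgc t) q = 0}}
  have hT : IsClosed (⋃ t, T t) := by
    refine isClosed_iUnion_of_finite fun t => IsClosed.inter ?_ ?_
    · exact isClosed_eq ((continuous_stoneCechExtend _).comp hι) continuous_const
    · exact (HyperExp.isClosed_subset
        (isClosed_eq (continuous_stoneCechExtend _) continuous_const)).preimage hF.1
  have hTu : ⋃ t, T t = univ := by
    refine hT.closure_eq ▸ (denseRange_stoneCechUnit.mono ?_).closure_eq
    rintro _ ⟨x, rfl⟩
    obtain ⟨t, ht⟩ := mem_iUnion.1 (hVc ▸ mem_univ (x : Z))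
    refine mem_iUnion.2 ⟨t, ?_, ?_⟩
    · change stoneCechExtend (hgc t) _ = 1
      rw [betaInclusion_unit, stoneCechExtend_stoneCechUnit]
      exact hg1 t _ ht
    · change (F (stoneCechUnit x)).carrier ⊆ _
      rw [hF.2]
      rintro _ ⟨y, hy, rfl⟩
      change stoneCechExtend (hgc t) _ = 0
      rw [stoneCechExtend_stoneCechUnit]
      exact hg0 t y fun hyW => (hW t x (hVW t ht)).le_bot ⟨hy, hyW⟩
  intro p hp
  obtain ⟨t, h1, h0⟩ := mem_iUnion.1 (hTu ▸ mem_univ p)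
  have h0' : stoneCechExtend (hgc t) (betaInclusion X p) = 0 := h0 hp
  exact zero_ne_one (h0'.symm.trans h1)

/-! ### Coloured covers of Euclidean space -/

/-- A form of "covering dimension less than the number of elements of `κ`": compact sets have
arbitrarily fine finite open covers made up of `κ` many families of sets with disjoint closures. -/
def HasColoredCovers (κ E : Type*) [TopologicalSpace E] : Prop :=
  ∀ (C : Set E), IsCompact C → ∀ O : E → Set E, (∀ x ∈ C, O x ∈ 𝓝 x) →
    ∃ (N : ℕ) (U : Fin N → Set E) (cls : Fin N → κ), (∀ i, IsOpen (U i)) ∧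
      (∀ i j, i ≠ j → cls i = cls j → Disjoint (closure (U i)) (closure (U j))) ∧
      C ⊆ ⋃ i, U i ∧ ∀ i, ∃ x ∈ C, U i ⊆ O x

/-- The open cube of side `3 ε / 2` centred at `ε v`. -/
def gridCube {k : ℕ} (ε : ℝ) (v : Fin k → ℤ) : Set (EuclideanSpace ℝ (Fin k)) :=
  {x | ∀ i, |x i - ε * v i| < 3 / 4 * ε}

theorem isOpen_gridCube {k : ℕ} (ε : ℝ) (v : Fin k → ℤ) : IsOpen (gridCube ε v) := by
  simp only [gridCube, ofPred_forall]
  exact isOpen_iInter_of_finite fun i => isOpen_lt (by fun_prop) continuous_const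

theorem closure_gridCube_subset {k : ℕ} (ε : ℝ) (v : Fin k → ℤ) :
    closure (gridCube ε v) ⊆ {x | ∀ i, |x i - ε * v i| ≤ 3 / 4 * ε} := by
  refine closure_minimal (fun x hx i => (hx i).le) ?_
  simp only [ofPred_forall]
  exact isClosed_iInter fun i => isClosed_le (by fun_prop) continuous_const

theorem exists_mem_gridCube {k : ℕ} {ε : ℝ} (hε : 0 < ε) (x : EuclideanSpace ℝ (Fin k)) :
    ∃ v, x ∈ gridCube ε v := by
  refine ⟨fun i => round (x i / ε), fun i => ?_⟩
  have h := abs_sub_round (x i / ε)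
  have : x i - ε * round (x i / ε) = ε * (x i / ε - round (x i / ε)) := by field_simp
  rw [this, abs_mul, abs_of_pos hε]
  nlinarith

/-- Distinct centres of equal parity are at least `2 ε` apart in some coordinate, more than the side
`3 ε / 2`. -/
theorem disjoint_closure_gridCube {k : ℕ} {ε : ℝ} (hε : 0 < ε) {v w : Fin k → ℤ} (hvw : v ≠ w)
    (h : ∀ i, (v i : ZMod 2) = w i) :
    Disjoint (closure (gridCube ε v)) (closure (gridCube ε w)) := by
  refine disjoint_left.2 fun x hx hy => hvw (funext fun i => ?_)
  have h1 := abs_le.1 (closure_gridCube_subset ε v hx i)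
  have h2 := abs_le.1 (closure_gridCube_subset ε w hy i)
  have h3 : ε * ((v i : ℝ) - w i) < ε * 2 := by linarith
  have h4 : ε * ((w i : ℝ) - v i) < ε * 2 := by linarith
  have h5 := lt_of_mul_lt_mul_left h3 hε.le
  have h6 := lt_of_mul_lt_mul_left h4 hε.le
  have h7 : v i - w i < 2 := by exact_mod_cast h5
  have h8 : w i - v i < 2 := by exact_mod_cast h6
  have h9 := (ZMod.intCast_eq_intCast_iff_dvd_sub _ _ 2).1 (h i)
  omega

/-- The norm is bounded by the sum of the coordinates; `k + 1` in place of `k` keeps the inequality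
strict for `k = 0`. -/
theorem dist_lt_of_mem_gridCube {k : ℕ} {ε : ℝ} {v : Fin k → ℤ}
    {x y : EuclideanSpace ℝ (Fin k)} (hx : x ∈ gridCube ε v) (hy : y ∈ gridCube ε v) (hε : 0 < ε) :
    dist x y < 2 * (k + 1) * ε := by
  rw [dist_eq_norm]
  have h1 : ‖x - y‖ ≤ ∑ i, |(x - y) i| := by
    have h0 : ∀ i ∈ (Finset.univ : Finset (Fin k)), 0 ≤ |(x - y) i| := fun i _ => abs_nonneg _
    rw [EuclideanSpace.norm_eq, Real.sqrt_le_left (Finset.sum_nonneg h0)]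
    simpa using Finset.sum_sq_le_sq_sum_of_nonneg h0
  have h2 : ∑ i, |(x - y) i| ≤ ∑ i : Fin k, 2 * ε := by
    refine Finset.sum_le_sum fun i _ => ?_
    have h1 := abs_lt.1 (hx i)
    have h2 := abs_lt.1 (hy i)
    rw [PiLp.sub_apply, abs_le]
    constructor <;> linarith
  simp only [Finset.sum_const, Finset.card_univ, Fintype.card_fin, nsmul_eq_mul] at h2
  nlinarith

theorem finite_gridCube_meets {k : ℕ} {ε : ℝ} (hε : 0 < ε) {C : Set (EuclideanSpace ℝ (Fin k))}
    (hC : Bornology.IsBounded C) : {v : Fin k → ℤ | (gridCube ε v ∩ C).Nonempty}.Finite := by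
  obtain ⟨R, hR⟩ := hC.exists_norm_le
  obtain ⟨M, hM⟩ := exists_nat_gt (R / ε + 1)
  refine (finite_Icc (fun _ : Fin k => -(M : ℤ)) fun _ => (M : ℤ)).subset ?_
  rintro v ⟨x, hx, hxC⟩
  have hb : ∀ i, |(v i : ℝ)| ≤ M := by
    intro i
    have h1 := abs_lt.1 (hx i)
    have h2 := abs_le.1 ((PiLp.norm_apply_le x i).trans (hR x hxC))
    have h3 : ε * (R / ε + 1) < ε * M := mul_lt_mul_of_pos_left hM hε
    have h4 : ε * (R / ε + 1) = R + ε := by field_simp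
    rw [abs_le]
    constructor
    · refine le_of_mul_le_mul_left ?_ hε
      linarith
    · refine le_of_mul_le_mul_left ?_ hε
      linarith
  constructor
  · intro i
    exact_mod_cast (abs_le.1 (hb i)).1
  · intro i
    exact_mod_cast (abs_le.1 (hb i)).2

theorem hasColoredCovers_euclideanSpace (k : ℕ) :
    HasColoredCovers (Fin k → ZMod 2) (EuclideanSpace ℝ (Fin k)) := by
  intro C hC O hO
  obtain ⟨δ, hδ, hball⟩ := lebesgue_number_lemma_of_metric (c := fun x : C => interior (O x)) hC
    (fun _ => isOpen_interior)
    fun x hx => mem_iUnion.2 ⟨⟨x, hx⟩, mem_interior_iff_mem_nhds.2 (hO x hx)⟩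
  set ε : ℝ := δ / (2 * (k + 1)) with hεdef
  have hε : 0 < ε := by positivity
  have hfin := finite_gridCube_meets hε hC.isBounded
  have := hfin.fintype
  let e := (Fintype.equivFin {v : Fin k → ℤ | (gridCube ε v ∩ C).Nonempty}).symm
  refine ⟨_, fun i => gridCube ε (e i).1, fun i j => ((e i).1 j : ZMod 2),
    fun i => isOpen_gridCube _ _, fun i j hij h => disjoint_closure_gridCube hε
      (fun h' => hij (e.injective (Subtype.ext h'))) fun l => congrFun h l, fun x hx => ?_,
    fun i => ?_⟩
  · obtain ⟨v, hv⟩ := exists_mem_gridCube hε x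
    refine mem_iUnion.2 ⟨e.symm ⟨v, x, hv, hx⟩, ?_⟩
    simpa using hv
  · obtain ⟨x, hx, hxC⟩ := (e i).2
    obtain ⟨z, hz⟩ := hball x hxC
    refine ⟨z, z.2, fun y hy => interior_subset (hz ?_)⟩
    have := dist_lt_of_mem_gridCube hy hx hε
    rw [Metric.mem_ball]
    convert this using 1
    rw [hεdef]
    field_simp

/-- Each small set takes the colour of one `O c` containing it. Closures of sets of one class are
disjoint, so a point lies in at most one per class. -/
theorem HasColoredCovers.exists_refinement {κ E : Type*} [Fintype κ] [TopologicalSpace E]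
    (hE : HasColoredCovers κ E) {L : ℕ} {C : Set E} (hC : IsCompact C) {O : Fin L → Set E}
    (hO : ∀ c, IsOpen (O c)) (hCO : C ⊆ ⋃ c, O c) :
    ∃ B : Fin L → Set E, (∀ c, IsOpen (B c)) ∧ (∀ c, B c ⊆ O c) ∧ C ⊆ ⋃ c, B c ∧
      ∀ y, {c | y ∈ closure (B c)}.ncard ≤ Fintype.card κ := by
  have hcol : ∀ x : C, ∃ c, (x : E) ∈ O c := fun x => mem_iUnion.1 (hCO x.2)
  choose c hc using hcol
  obtain ⟨N, U, cls, hUo, hUd, hCU, hUO⟩ := hE C hC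
    (fun x => {y | ∃ h : x ∈ C, y ∈ O (c ⟨x, h⟩)}) fun x hx => by
      filter_upwards [(hO (c ⟨x, hx⟩)).mem_nhds (hc ⟨x, hx⟩)] with y hy using ⟨hx, hy⟩
  have hsub : ∀ i, ∃ c, U i ⊆ O c := by
    intro i
    obtain ⟨x, hx, h⟩ := hUO i
    exact ⟨c ⟨x, hx⟩, fun y hy => (h hy).2⟩
  choose col hcol using hsub
  refine ⟨fun c => ⋃ i : {i // col i = c}, U i, fun c => isOpen_iUnion fun i => hUo i,
    fun c => iUnion_subset fun i => (hcol i).trans_eq (congrArg O i.2), fun x hx => ?_, fun y => ?_⟩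
  · obtain ⟨i, hi⟩ := mem_iUnion.1 (hCU hx)
    exact mem_iUnion.2 ⟨col i, mem_iUnion.2 ⟨⟨i, rfl⟩, hi⟩⟩
  · have h1 : {c | y ∈ closure (⋃ i : {i // col i = c}, U i)} ⊆
        col '' {i | y ∈ closure (U i)} := by
      intro c hc
      rw [mem_ofPred, closure_iUnion_of_finite] at hc
      obtain ⟨i, hi⟩ := mem_iUnion.1 hc
      exact ⟨i, hi, i.2⟩
    have h2 : InjOn cls {i | y ∈ closure (U i)} := by
      intro i hi j hj hij
      by_contra hne
      exact (hUd i j hne hij).le_bot ⟨hi, hj⟩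
    calc _ ≤ (col '' {i | y ∈ closure (U i)}).ncard := ncard_le_ncard h1
      _ ≤ {i | y ∈ closure (U i)}.ncard := ncard_image_le
      _ = (cls '' {i | y ∈ closure (U i)}).ncard := h2.ncard_image.symm
      _ ≤ (univ : Set κ).ncard := ncard_le_ncard (subset_univ _)
      _ = Fintype.card κ := by rw [ncard_univ, Nat.card_eq_fintype_card]

/-! ### Greedy colouring of cells -/

section Coloring

variable {κ E : Type*} [Fintype κ] [TopologicalSpace E] {X : Set E} {Φ : X → Set E} {n L : ℕ}

theorem exists_disjoint_closure_of_encard_le (hL : n * Fintype.card κ < L) {A : Fin L → Set E}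
    (hA : ∀ y, {c | y ∈ closure (A c)}.ncard ≤ Fintype.card κ) {s : Set E} (hs : s.encard ≤ n) :
    ∃ c, s ⊆ (closure (A c))ᶜ := by
  classical
  by_contra! h
  have hfin := finite_of_encard_le_coe hs
  have hcard : hfin.toFinset.card ≤ n := by
    rw [hfin.encard_eq_coe_toFinset_card] at hs
    exact_mod_cast hs
  have hu : (Finset.univ : Finset (Fin L)) ⊆
      hfin.toFinset.biUnion fun y => {c | y ∈ closure (A c)}.toFinite.toFinset := by
    intro c _
    obtain ⟨y, hy, hyA⟩ := not_subset.1 (h c)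
    rw [Finset.mem_biUnion]
    exact ⟨y, by simpa using hy, by simpa using hyA⟩
  have h1 := (Finset.card_le_card hu).trans
    (Finset.card_biUnion_le_card_mul _ _ (Fintype.card κ) fun y _ => by
      rw [← ncard_eq_toFinset_card]
      exact hA y)
  rw [Finset.card_univ, Fintype.card_fin] at h1
  exact absurd (h1.trans (Nat.mul_le_mul_right _ hcard)) (not_le.2 hL)

theorem HasColoredCovers.exists_disjoint_from (hE : HasColoredCovers κ E) (hX : IsClosed X)
    (hΦ : ∀ U, IsOpen U → IsOpen {x | Φ x ⊆ U}) (hn : ∀ x, (Φ x).encard ≤ n)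
    (hL : n * Fintype.card κ < L) {A : Fin L → Set E}
    (hA : ∀ y, {c | y ∈ closure (A c)}.ncard ≤ Fintype.card κ) {P : Set E} (hPo : IsOpen P)
    (hPc : IsCompact (closure P)) :
    ∃ B : Fin L → Set E, (∀ c, IsOpen (B c)) ∧ (∀ c, B c ⊆ P) ∧ P ⊆ ⋃ c, B c ∧
      (∀ y, {c | y ∈ closure (B c)}.ncard ≤ Fintype.card κ) ∧
      ∀ c (x : X), (x : E) ∈ B c → Disjoint (Φ x) (A c) := by
  have hG : ∀ c, ∃ G : Set E, IsOpen G ∧ Subtype.val ⁻¹' G = {x : X | Φ x ⊆ (closure (A c))ᶜ} :=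
    fun c => isOpen_induced_iff.1 (hΦ _ isClosed_closure.isOpen_compl)
  choose G hGo hG using hG
  -- Points off `X` carry no constraint, so every colour is open to them.
  obtain ⟨B, hBo, hBO, hPB, hB⟩ := hE.exists_refinement hPc
    (O := fun c => G c ∪ Xᶜ) (fun c => (hGo c).union hX.isOpen_compl) (fun x _ => by
      by_cases hx : x ∈ X
      · obtain ⟨c, hc⟩ := exists_disjoint_closure_of_encard_le hL hA (hn ⟨x, hx⟩)
        refine mem_iUnion.2 ⟨c, Or.inl ?_⟩
        have : (⟨x, hx⟩ : X) ∈ Subtype.val ⁻¹' G c := by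
          rw [hG]
          exact hc
        exact this
      · exact mem_iUnion.2 ⟨⟨0, by omega⟩, Or.inr hx⟩)
  refine ⟨fun c => B c ∩ P, fun c => (hBo c).inter hPo, fun c => inter_subset_right,
    fun x hx => ?_, fun y => ?_, fun c x hx => ?_⟩
  · obtain ⟨c, hc⟩ := mem_iUnion.1 (hPB (subset_closure hx))
    exact mem_iUnion.2 ⟨c, hc, hx⟩
  · refine (ncard_le_ncard fun c hc => ?_).trans (hB y)
    exact closure_mono inter_subset_left hc
  · have h1 : x ∈ Subtype.val ⁻¹' G c := (hBO c hx.1).resolve_right fun h => h x.2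
    rw [hG] at h1
    exact disjoint_left.2 fun y hy hyA => h1 hy (subset_closure hyA)

/-- Colouring of a sequence of cells such that no point is sent to an earlier cell of its own
colour. -/
theorem HasColoredCovers.exists_coloring_seq (hE : HasColoredCovers κ E) (hX : IsClosed X)
    (hΦ : ∀ U, IsOpen U → IsOpen {x | Φ x ⊆ U}) (hn : ∀ x, (Φ x).encard ≤ n)
    (hL : n * Fintype.card κ < L) {P : ℕ → Set E} (hPo : ∀ i, IsOpen (P i))
    (hPc : ∀ i, IsCompact (closure (P i)))
    (hPd : ∀ i j, i ≠ j → Disjoint (closure (P i)) (closure (P j))) :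
    ∃ A : Fin L → Set E, (∀ c, IsOpen (A c)) ∧ ⋃ c, A c = ⋃ i, P i ∧
      ∀ c i j (x : X) y, (x : E) ∈ A c → (x : E) ∈ P i → y ∈ Φ x → y ∈ A c → y ∈ P j → i ≤ j := by
  have step := fun i (A : Fin L → Set E)
    (hA : ∀ y, {c | y ∈ closure (A c)}.ncard ≤ Fintype.card κ) =>
      hE.exists_disjoint_from hX hΦ hn hL hA (hPo i) (hPc i)
  choose! B hBo hBP hPB hB hBA using step
  -- `A i` colours the first `i` cells. The multiplicity bound is needed only for these finite
  -- stages.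
  let A : ℕ → Fin L → Set E := fun i => Nat.rec (fun _ => ∅) (fun i A c => A c ∪ B i A c) i
  have hA1 : ∀ i c, A (i + 1) c = A i c ∪ B i (A i) c := fun i c => rfl
  have hA : ∀ i, (∀ y, {c | y ∈ closure (A i c)}.ncard ≤ Fintype.card κ) ∧
      ∀ c, closure (A i c) ⊆ ⋃ j : Fin i, closure (P j) := by
    intro i
    induction i with
    | zero => simp [A]
    | succ i ih =>
      have hBP' : ∀ c, closure (B i (A i) c) ⊆ closure (P i) :=
        fun c => closure_mono (hBP i _ ih.1 c)
      simp only [hA1, closure_union]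
      constructor
      · intro y
        -- The new cell and the old ones have disjoint closures, so the old and new multiplicities
        -- never add up at a point.
        by_cases hy : y ∈ closure (P i)
        · refine (ncard_le_ncard fun c hc => ?_).trans (hB i _ ih.1 y)
          refine hc.resolve_left fun h => ?_
          obtain ⟨j, hj⟩ := mem_iUnion.1 (ih.2 c h)
          exact (hPd i j j.2.ne').le_bot ⟨hy, hj⟩
        · exact (ncard_le_ncard fun c hc => hc.resolve_right fun h => hy (hBP' c h)).trans (ih.1 y)
      · refine fun c => union_subset ((ih.2 c).trans ?_) ((hBP' c).trans ?_)
        · exact iUnion_subset fun j => subset_iUnion_of_subset j.castSucc subset_rfl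
        · exact subset_iUnion_of_subset (Fin.last i) subset_rfl
  have hmono : ∀ c, Monotone fun i => A i c := fun c => monotone_nat_of_le_succ fun i => by
    simp only [hA1]
    exact subset_union_left
  have huniq : ∀ i j x, x ∈ P i → x ∈ P j → i = j := by
    intro i j x hi hj
    by_contra hij
    exact (hPd i j hij).le_bot ⟨subset_closure hi, subset_closure hj⟩
  refine ⟨fun c => ⋃ i, B i (A i) c, fun c => isOpen_iUnion fun i => hBo i _ (hA i).1 c, ?_, ?_⟩
  · rw [iUnion_comm]
    exact iUnion_congr fun i =>
      (iUnion_subset fun c => hBP i _ (hA i).1 c).antisymm (hPB i _ (hA i).1)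
  · intro c i j x y hxA hxi hyx hyA hyj
    by_contra! hji
    obtain ⟨i', hi'⟩ := mem_iUnion.1 hxA
    obtain ⟨j', hj'⟩ := mem_iUnion.1 hyA
    obtain rfl := huniq i i' x hxi (hBP _ _ (hA i').1 c hi')
    obtain rfl := huniq j j' y hyj (hBP _ _ (hA j').1 c hj')
    refine (hBA i _ (hA i).1 c x hi').le_bot ⟨hyx, hmono c (Nat.succ_le_of_lt hji) ?_⟩
    simp only [Nat.succ_eq_add_one, hA1]
    exact Or.inr hj'

theorem HasColoredCovers.exists_coloring_rank (hE : HasColoredCovers κ E) (hX : IsClosed X)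
    (hΦ : ∀ U, IsOpen U → IsOpen {x | Φ x ⊆ U}) (hn : ∀ x, (Φ x).encard ≤ n)
    (hL : n * Fintype.card κ < L) {J : Type*} {P : J → Set E} (hPo : ∀ i, IsOpen (P i))
    (hPc : ∀ i, IsCompact (closure (P i)))
    (hPd : ∀ i j, i ≠ j → Disjoint (closure (P i)) (closure (P j))) {rank : J → ℕ}
    (hr : Function.Injective rank) :
    ∃ A : Fin L → Set E, (∀ c, IsOpen (A c)) ∧ ⋃ c, A c = ⋃ i, P i ∧
      ∀ c i j (x : X) y, (x : E) ∈ A c → (x : E) ∈ P i → y ∈ Φ x → y ∈ A c → y ∈ P j →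
        rank i ≤ rank j := by
  let P' : ℕ → Set E := Function.extend rank P fun _ => ∅
  have hP' : ∀ i, P' (rank i) = P i := fun i => hr.extend_apply _ _ i
  have hP'0 : ∀ t, (∃ i, rank i = t) ∨ P' t = ∅ := fun t =>
    or_iff_not_imp_left.2 fun h => Function.extend_apply' _ _ _ h
  obtain ⟨A, hAo, hAu, hA⟩ := hE.exists_coloring_seq (P := P') hX hΦ hn hL
    (fun t => by
      rcases hP'0 t with ⟨i, rfl⟩ | h
      · exact hP' i ▸ hPo i
      · simp [h])
    (fun t => by
      rcases hP'0 t with ⟨i, rfl⟩ | h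
      · exact hP' i ▸ hPc i
      · simp [h])
    (fun s t hst => by
      rcases hP'0 s with ⟨i, rfl⟩ | h
      · rcases hP'0 t with ⟨j, rfl⟩ | h
        · rw [hP', hP']
          exact hPd i j fun h => hst (h ▸ rfl)
        · simp [h]
      · simp [h])
  refine ⟨A, hAo, hAu.trans (Subset.antisymm ?_ ?_), fun c i j x y hxA hxi hyx hyA hyj => ?_⟩
  · refine iUnion_subset fun t => ?_
    rcases hP'0 t with ⟨i, rfl⟩ | h
    · rw [hP']
      exact subset_iUnion P i
    · simp [h]
  · exact iUnion_subset fun i => subset_iUnion_of_subset (rank i) (hP' i).ge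
  · exact hA c _ _ x y hxA (by rwa [hP']) hyx hyA (by rwa [hP'])

/-- Colouring of cells arranged in finite levels, if no point is sent to a higher level. -/
theorem HasColoredCovers.exists_coloring_levels (hE : HasColoredCovers κ E) (hX : IsClosed X)
    (hΦ : ∀ U, IsOpen U → IsOpen {x | Φ x ⊆ U}) (hn : ∀ x, (Φ x).encard ≤ n)
    (hL : n * Fintype.card κ < L) {N : ℕ → ℕ} {q : (Σ m, Fin (N m)) → Prop}
    {P : (Σ m, Fin (N m)) → Set E} (hPo : ∀ i, IsOpen (P i)) (hPc : ∀ i, IsCompact (closure (P i)))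
    (hPd : ∀ i j, q i → q j → i ≠ j → Disjoint (closure (P i)) (closure (P j)))
    (hPΦ : ∀ i (x : X), (x : E) ∈ P i → Disjoint (Φ x) (P i))
    (hPl : ∀ i j (x : X) y, q i → q j → (x : E) ∈ P i → y ∈ Φ x → y ∈ P j → j.1 ≤ i.1) :
    ∃ W : Fin L × Fin L → Set E, (∀ t, IsOpen (W t)) ∧ (∀ i, q i → P i ⊆ ⋃ t, W t) ∧
      ∀ t (x : X), (x : E) ∈ W t → Disjoint (Φ x) (W t) := by
  let p : ℕ → ℕ := fun m => ∑ l ∈ Finset.range m, N l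
  have hp : ∀ {m m'}, m < m' → p m + N m ≤ p m' := by
    intro m m' h
    rw [← Finset.sum_range_succ]
    exact Finset.sum_le_sum_of_subset (Finset.range_subset_range.2 h)
  -- Both ranks list the levels in increasing order; `r₂` reverses the order inside each level.
  let r₁ : {i // q i} → ℕ := fun i => p i.1.1 + i.1.2
  let r₂ : {i // q i} → ℕ := fun i => p i.1.1 + i.1.2.rev
  have hr : ∀ (g : ∀ m, Fin (N m) → Fin (N m)) (i j : {i // q i}), i.1.1 < j.1.1 →
      p i.1.1 + g _ i.1.2 < p j.1.1 + g _ j.1.2 := by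
    intro g i j hij
    have h1 := hp hij
    have h2 := (g _ i.1.2).2
    omega
  have hinj : ∀ (g : ∀ m, Fin (N m) → Fin (N m)), (∀ m, Function.Injective (g m)) →
      Function.Injective fun i : {i // q i} => p i.1.1 + (g _ i.1.2 : ℕ) := by
    rintro g hg ⟨⟨m, i⟩, hi⟩ ⟨⟨m', j⟩, hj⟩ hij
    rcases lt_trichotomy m m' with h | rfl | h
    · exact absurd hij (hr g ⟨⟨m, i⟩, hi⟩ ⟨⟨m', j⟩, hj⟩ h).ne
    · simp only [Nat.add_left_cancel_iff] at hij
      obtain rfl := hg _ (Fin.ext hij)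
      rfl
    · exact absurd hij (hr g ⟨⟨m', j⟩, hj⟩ ⟨⟨m, i⟩, hi⟩ h).ne'
  have key := fun (r : {i // q i} → ℕ) (hr : Function.Injective r) =>
    hE.exists_coloring_rank hX hΦ hn hL (P := fun i : {i // q i} => P i) (fun i => hPo i)
      (fun i => hPc i) (fun i j hij => hPd i j i.2 j.2 fun h => hij (Subtype.ext h)) hr
  obtain ⟨A, hAo, hAu, hA⟩ := key r₁ (hinj (fun _ i => i) fun _ => Function.injective_id)
  obtain ⟨A', hAo', hAu', hA'⟩ := key r₂ (hinj (fun _ i => i.rev) fun _ => Fin.rev_injective)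
  refine ⟨fun t => A t.1 ∩ A' t.2, fun t => (hAo _).inter (hAo' _), fun i hi x hx => ?_, ?_⟩
  · have hxu : x ∈ ⋃ i : {i // q i}, P i := mem_iUnion.2 ⟨⟨i, hi⟩, hx⟩
    obtain ⟨c, hc⟩ := mem_iUnion.1 (hAu.ge hxu)
    obtain ⟨c', hc'⟩ := mem_iUnion.1 (hAu'.ge hxu)
    exact mem_iUnion.2 ⟨(c, c'), hc, hc'⟩
  · rintro ⟨c, c'⟩ x ⟨hx, hx'⟩
    refine disjoint_left.2 fun y hyx ⟨hy, hy'⟩ => ?_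
    obtain ⟨i, hi⟩ := mem_iUnion.1 (hAu.le (mem_iUnion.2 ⟨c, hx⟩))
    obtain ⟨j, hj⟩ := mem_iUnion.1 (hAu.le (mem_iUnion.2 ⟨c, hy⟩))
    have h1 := hA c i j x y hx hi hyx hy hj
    have h2 := hA' c' i j x y hx' hi hyx hy' hj
    have hl := hPl i j x y i.2 j.2 hi hyx hj
    rcases hl.lt_or_eq with hl | hl
    · exact absurd (hr (fun _ i => i) j i hl) (not_lt.2 h1)
    · obtain ⟨⟨m, i⟩, hqi⟩ := i
      obtain ⟨⟨m', j⟩, hqj⟩ := j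
      obtain rfl : m' = m := hl
      simp only [r₁, r₂, Nat.add_le_add_iff_left, Fin.val_fin_le, Fin.rev_le_rev] at h1 h2
      obtain rfl := h1.antisymm h2
      exact (hPΦ _ x hi).le_bot ⟨hyx, hj⟩

end Coloring

theorem exists_nhds_disjoint_image {E : Type*} [TopologicalSpace E] [T3Space E] {X : Set E}
    (hX : IsClosed X) {Φ : X → Set E} (hΦ : ∀ U, IsOpen U → IsOpen {x | Φ x ⊆ U})
    (hcl : ∀ x, IsClosed (Φ x)) (hfp : ∀ x : X, (x : E) ∉ Φ x) (x : E) :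
    ∃ O ∈ 𝓝 x, ∀ z : X, (z : E) ∈ O → Disjoint (Φ z) O := by
  by_cases hx : x ∈ X
  · obtain ⟨V, U, hV, hU, hxV, hxU, hUV⟩ :=
      (separatedNhds_iff_disjoint (s := Φ ⟨x, hx⟩) (t := {x})).2 (by
        rw [nhdsSet_singleton]
        exact RegularSpace.regular (hcl _) (hfp ⟨x, hx⟩))
    obtain ⟨G, hG, hGV⟩ := isOpen_induced_iff.1 (hΦ V hV)
    have hxG : (⟨x, hx⟩ : X) ∈ Subtype.val ⁻¹' G := by
      rw [hGV]
      exact hxV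
    refine ⟨U ∩ G, (hU.inter hG).mem_nhds ⟨hxU rfl, hxG⟩, fun z hz => ?_⟩
    have hzV : z ∈ Subtype.val ⁻¹' G := hz.2
    rw [hGV] at hzV
    exact hUV.mono hzV inter_subset_left
  · exact ⟨Xᶜ, hX.isOpen_compl.mem_nhds hx, fun z hz => absurd z.2 hz⟩

/-! ### Shells adapted to the map -/

section Shells

variable {E : Type*} [NormedAddCommGroup E] [ProperSpace E] {X : Set E} {Φ : X → Set E}

theorem exists_radius_image_subset (hX : IsClosed X)
    (hΦ : ∀ U, IsOpen U → IsOpen {x | Φ x ⊆ U}) (hfin : ∀ x, (Φ x).Finite) (r : ℝ) :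
    ∃ r', r + 1 < r' ∧ ∀ x : X, ‖(x : E)‖ ≤ r → Φ x ⊆ Metric.ball 0 r' := by
  have hK : IsCompact {x : X | ‖(x : E)‖ ≤ r} := by
    have h := hX.isClosedEmbedding_subtypeVal.isCompact_preimage
      (isCompact_closedBall (0 : E) r)
    convert h using 1
    ext x
    simp
  obtain ⟨t, ht⟩ := hK.elim_directed_cover
    (fun m : ℕ => {x : X | Φ x ⊆ Metric.ball 0 (m : ℝ)}) (fun m => hΦ _ Metric.isOpen_ball)
    (fun x _ => by
      obtain ⟨R, hR⟩ := (hfin x).isBounded.subset_ball (0 : E)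
      obtain ⟨m, hm⟩ := exists_nat_ge R
      exact mem_iUnion.2 ⟨m, hR.trans (Metric.ball_subset_ball hm)⟩)
    (Monotone.directed_le fun m m' h x hx =>
      hx.trans (Metric.ball_subset_ball (by exact_mod_cast h)))
  refine ⟨max (r + 2) t, lt_max_of_lt_left (by linarith), fun x hx => ?_⟩
  exact (ht hx).trans (Metric.ball_subset_ball (le_max_right _ _))

/-- Each radius exceeds the previous one by more than `1`, so the radii are unbounded. The start `r
0 < 0` puts the origin into an open shell. -/
theorem exists_radii (hX : IsClosed X)
    (hΦ : ∀ U, IsOpen U → IsOpen {x | Φ x ⊆ U}) (hfin : ∀ x, (Φ x).Finite) :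
    ∃ r : ℕ → ℝ, StrictMono r ∧ r 0 < 0 ∧ (∀ R, ∃ m, R < r m) ∧
      ∀ m (x : X), ‖(x : E)‖ ≤ r m → Φ x ⊆ Metric.ball 0 (r (m + 1)) := by
  choose g hg hgΦ using exists_radius_image_subset hX hΦ hfin
  let r : ℕ → ℝ := fun m => Nat.rec (-1) (fun _ s => g s) m
  have hr : ∀ m, r (m + 1) = g (r m) := fun m => rfl
  have hr0 : r 0 = -1 := rfl
  have hlow : ∀ m : ℕ, (m : ℝ) - 1 ≤ r m := by
    intro m
    induction m with
    | zero => simp [hr0]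
    | succ m ih =>
      have := hg (r m)
      rw [hr]
      push_cast
      linarith
  refine ⟨r, strictMono_nat_of_lt_succ fun m => ?_, by norm_num [hr0], fun R => ?_, fun m x hx => ?_⟩
  · have := hg (r m)
    rw [hr]
    linarith
  · obtain ⟨m, hm⟩ := exists_nat_gt (R + 1)
    exact ⟨m, by linarith [hlow m]⟩
  · rw [hr]
    exact hgΦ _ x hx

/-- Finite open colouring of a fixed-point free multivalued map with finite values. -/
theorem HasColoredCovers.exists_coloring {κ : Type*} [Fintype κ] (hE : HasColoredCovers κ E)
    (hX : IsClosed X) (hΦ : ∀ U, IsOpen U → IsOpen {x | Φ x ⊆ U}) {n : ℕ}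
    (hn : ∀ x, (Φ x).encard ≤ n) (hfp : ∀ x : X, (x : E) ∉ Φ x) {L : ℕ}
    (hL : n * Fintype.card κ < L) :
    ∃ W : (Fin 3 × κ) × (Fin L × Fin L) → Set E, (∀ t, IsOpen (W t)) ∧ ⋃ t, W t = univ ∧
      ∀ t (x : X), (x : E) ∈ W t → Disjoint (Φ x) (W t) := by
  have hfin : ∀ x, (Φ x).Finite := fun x => finite_of_encard_le_coe (hn x)
  obtain ⟨r, hrm, hr0, hrR, hrΦ⟩ := exists_radii hX hΦ hfin
  choose O hO hOΦ using exists_nhds_disjoint_image hX hΦ (fun x => (hfin x).isClosed) hfp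
  have hC : ∀ m, IsCompact {x : E | r m ≤ ‖x‖ ∧ ‖x‖ ≤ r (m + 2)} := by
    intro m
    refine (isCompact_closedBall (0 : E) (r (m + 2))).of_isClosed_subset ?_ fun x hx => by
      simpa using hx.2
    exact (isClosed_le continuous_const continuous_norm).inter
      (isClosed_le continuous_norm continuous_const)
  choose N U cls hUo hUd hCU hUO using fun m => hE _ (hC m) O fun x _ => hO x
  -- Consecutive shells overlap, so the open shells cover; shells with indices at least `3` apart
  -- have disjoint closures.
  let P : (Σ m, Fin (N m)) → Set E := fun i => U i.1 i.2 ∩ {x | r i.1 < ‖x‖ ∧ ‖x‖ < r (i.1 + 2)}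
  have hPcl : ∀ i, closure (P i) ⊆ {x | r i.1 ≤ ‖x‖ ∧ ‖x‖ ≤ r (i.1 + 2)} := fun i =>
    closure_minimal (fun x hx => ⟨hx.2.1.le, hx.2.2.le⟩) (hC i.1).isClosed
  have hPd' : ∀ i j : Σ m, Fin (N m), i.1 + 3 ≤ j.1 →
      Disjoint (closure (P i)) (closure (P j)) := by
    intro i j hij
    refine disjoint_left.2 fun x hx hx' => ?_
    have h1 := (hPcl i hx).2
    have h2 := (hPcl j hx').1
    have h3 : r (i.1 + 2) < r j.1 := hrm (by omega)
    linarith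
  have key : ∀ s : Fin 3 × κ, _ := fun s =>
    hE.exists_coloring_levels hX hΦ hn hL (P := P) (q := fun i => i.1 % 3 = s.1 ∧ cls i.1 i.2 = s.2)
      (fun i => (hUo _ _).inter ((isOpen_lt continuous_const continuous_norm).inter
        (isOpen_lt continuous_norm continuous_const)))
      (fun i => (hC i.1).of_isClosed_subset isClosed_closure (hPcl i))
      (fun i j hi hj hij => by
        rcases lt_trichotomy i.1 j.1 with h | h | h
        · exact hPd' i j (by omega)
        · obtain ⟨m, i⟩ := i
          obtain ⟨m', j⟩ := j
          obtain rfl : m = m' := h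
          exact (hUd m i j (fun h => hij (h ▸ rfl)) (hi.2.trans hj.2.symm)).mono
            (closure_mono inter_subset_left) (closure_mono inter_subset_left)
        · exact (hPd' j i (by omega)).symm)
      (fun i x hx => by
        obtain ⟨z, -, hz⟩ := hUO i.1 i.2
        exact (hOΦ z x (hz hx.1)).mono_right (inter_subset_left.trans hz))
      -- Images of shell `m` lie within radius `r (m + 3)`, and the next shell of the same residue
      -- mod `3` begins there.
      (fun i j x y hi hj hx hyx hy => by
        by_contra! h
        have h1 := hrΦ (i.1 + 2) x hx.2.2.le hyx
        rw [mem_ball_zero_iff] at h1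
        have h2 : r (i.1 + 2 + 1) ≤ r j.1 := hrm.monotone (by omega)
        linarith [hy.2.1])
  choose W hWo hWP hW using key
  refine ⟨fun t => W t.1 t.2, fun t => hWo _ _, eq_univ_of_forall fun x => ?_,
    fun t x hx => hW _ _ x hx⟩
  obtain ⟨m, hm1, hm2⟩ : ∃ m, r m < ‖x‖ ∧ ‖x‖ < r (m + 2) := by
    classical
    have hex := hrR ‖x‖
    have hspec := Nat.find_spec hex
    have hmin := fun m => Nat.find_min hex (m := m)
    obtain ⟨l, hl⟩ : ∃ l, l = Nat.find hex := ⟨_, rfl⟩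
    rw [← hl] at hspec hmin
    rcases l with _ | _ | l
    · linarith [norm_nonneg x]
    · exact ⟨0, hr0.trans_le (norm_nonneg x), hspec.trans (hrm (by norm_num))⟩
    · refine ⟨l, ?_, hspec⟩
      have h1 := hmin (l + 1) (by omega)
      exact (hrm (Nat.lt_succ_self l)).trans_le (not_lt.1 h1)
  obtain ⟨i, hi⟩ := mem_iUnion.1 (hCU m ⟨hm1.le, hm2.le⟩)
  obtain ⟨t, ht⟩ := mem_iUnion.1 (hWP (⟨m % 3, Nat.mod_lt _ (by norm_num)⟩, cls m i) ⟨m, i⟩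
    ⟨rfl, rfl⟩ ⟨hi, hm1, hm2⟩)
  exact mem_iUnion.2 ⟨(_, t), ht⟩

end Shells

theorem mainTheorem2 (k n : ℕ) (X : Set (EuclideanSpace ℝ (Fin k))) (hX : IsClosed X)
    (f : X → HyperExp n (EuclideanSpace ℝ (Fin k))) (hf : Continuous f) :
    (∃! F : StoneCech X → HyperExp n (StoneCech (EuclideanSpace ℝ (Fin k))),
      IsBetaExtension f F) ∧
    ∀ F : StoneCech X → HyperExp n (StoneCech (EuclideanSpace ℝ (Fin k))),
      IsBetaExtension f F →
        (FixedPointFree (Subtype.val : X → EuclideanSpace ℝ (Fin k)) f ↔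
          FixedPointFree (betaInclusion X) F) := by
  refine ⟨existsUnique_isBetaExtension hf, fun F hF =>
    ⟨fun hfp => ?_, fun h => h.of_isBetaExtension hF⟩⟩
  obtain ⟨W, hWo, hWc, hW⟩ := (hasColoredCovers_euclideanSpace k).exists_coloring hX
    (Φ := fun x => (f x).carrier) (fun U hU => (HyperExp.isOpen_subset hU).preimage hf)
    (fun x => (f x).encard_carrier_le) hfp (Nat.lt_succ_self _)
  exact hF.fixedPointFree_of_cover hWo hWc hW
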